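/- Let $m\ge 2$, $k\ge 2$, $d\ge 1$ be integers, and let $X_n=(X_{n,1},\dots,X_{n,m})$, $n\ge1$, be random vectors in $(0,\infty)^m$ (the returns of $m$ assets) such that the blocks $(X_{kt+1},\dots,X_{kt+k})$, $t=0,1,2,\dots$, are independent and identically distributed. Let $\mathcal B^m=\{b\in\mathbb R^m: b_j\ge 0,\ \sum_{j} b_j=1\}$. For a strategy $(b_n)$, where the portfolio $b_n$ is a function of $X_1,\dots,X_{n-1}$, let $$W_n(b_n)=\frac1n\log\prod_{i=1}^n\langle b_i,X_i\rangle$$ be its growth rate after $n$ periods. Let $(b^{1*},\dots,b^{k*})$ be $k$-log-optimal portfolios for the joint law of $(X_1,\dots,X_k)$, that is, a maximizer of $\mathbb E\big(\sum_{i=1}^k\log\langle b^i,X_i\rangle\big)$ over all $(b^1,\dots,b^k)\in(\mathcal B^m)^k$; here all these expectations are assumed to be well defined in $[-\infty,\infty]$ and the maximum is assumed to be finite. Let $(b_n^{k*})$ be the $k$-cyclic constant strategy with $b^{k*}_{kt+i}=b^{i*}$ for all $1\le i\le k$, $t\ge0$. Put $K=dk$, let $\mu$ be either the uniform density or the Dirichlet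 $(1/2,\dots,1/2)$ density on $\mathcal B^m$, and let $(b_n)$ be the learning strategy with cycle length $K$, defined from the observed returns alone, without knowledge of their distribution, by $b_i=(1/m,\dots,1/m)$ for $1\le i\le K$ and $$b_{Kt+i}=\frac{\int_{\mathcal B^m} b\,\prod_{j=0}^{t-1}\langle b,X_{Kj+i}\rangle\,\mu(b)\,db}{\int_{\mathcal B^m}\prod_{j=0}^{t-1}\langle b,X_{Kj+i}\rangle\,\mu(b)\,db},\qquad 1\le i\le K,\ t\ge 1.$$ Then, almost surely, $$\lim_{t\to\infty}\big(W_{kt+k}(b_{kt+k})-W_{kt+k}(b^{k*}_{kt+k})\big)=0 .$$ -/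

import Mathlib

open MeasureTheory ProbabilityTheory Filter Topology

noncomputable section

namespace CyclicPortfolio

/-! Time is indexed from `0`: the returns of the `(n+1)`-st trading period are `x n`. Hence `x 0, …,
x (n-1)` are the returns of the first `n` periods, and the `t`-th block of length `k`
consists of `x (k*t), …, x (k*t + k - 1)`. -/

/-- A causal strategy for `m` assets: the portfolio of the period with index `n` is a function of
the `n` return vectors observed before. -/
abbrev Strategy (m : ℕ) : Type := (n : ℕ) → (Fin n → Fin m → ℝ) → Fin m → ℝ

/-- Cumulative wealth after `n` periods, with initial fortune `1`. -/
def wealth {m : ℕ} (b : Strategy m) (x : ℕ → Fin m → ℝ) (n : ℕ) : ℝ :=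
  ∏ i ∈ Finset.range n, (b i (fun s : Fin i => x s)) ⬝ᵥ (x i)

/-- Growth rate after `n` periods. -/
def growthRate {m : ℕ} (b : Strategy m) (x : ℕ → Fin m → ℝ) (n : ℕ) : ℝ :=
  (1 / (n : ℝ)) * Real.log (wealth b x n)

/-- The `k`-cyclic constant strategy that loops over the portfolios `b 0, …, b (k-1)`. -/
def cyclicStrategy {m k : ℕ} [NeZero k] (b : Fin k → Fin m → ℝ) : Strategy m :=
  fun n _ => b (Fin.ofNat k n)

/-- The projection of the simplex in `ℝ^m` to the first `m - 1` coordinates. -/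
def projectedSimplex (m : ℕ) : Set (Fin (m - 1) → ℝ) :=
  {y | (∀ i, 0 ≤ y i) ∧ ∑ i, y i ≤ 1}

/-- The vector with first coordinates `y` whose last coordinate makes the sum equal to `1`. -/
def completeCoords (m : ℕ) (y : Fin (m - 1) → ℝ) : Fin m → ℝ :=
  fun j => if h : (j : ℕ) < m - 1 then y ⟨j, h⟩ else 1 - ∑ i, y i

/-- The reference measure `db` on the simplex in `ℝ^m`: Lebesgue measure in the first `m - 1`
coordinates. -/
def simplexVolume (m : ℕ) : Measure (Fin m → ℝ) :=
  (volume.restrict (projectedSimplex m)).map (completeCoords m)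

/-- The uniform probability density on the simplex, with respect to `simplexVolume m`. -/
def uniformDensity (m : ℕ) : (Fin m → ℝ) → ℝ :=
  fun _ => ((m - 1).factorial : ℝ)

/-- The density of the Dirichlet `(a, …, a)` distribution with respect to `simplexVolume m`. -/
def dirichletDensity (m : ℕ) (a : ℝ) : (Fin m → ℝ) → ℝ :=
  fun b => Real.Gamma (m * a) / Real.Gamma a ^ m * ∏ j, b j ^ (a - 1)

theorem past_index_lt {n K : ℕ} (s : Fin (n / K)) : K * (s : ℕ) + n % K < n := by
  have hs := s.2
  rcases Nat.eq_zero_or_pos K with rfl | hK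
  · simp at hs
  · have h1 : K * ((s : ℕ) + 1) ≤ K * (n / K) := Nat.mul_le_mul_left K hs
    have h2 := Nat.div_add_mod n K
    rw [Nat.mul_add] at h1
    omega

/-- The wealth that the constant portfolio `b` earns on those of the `n` past periods whose index
is congruent to `n` modulo `K`. -/
def subsequenceWealth {m : ℕ} (K n : ℕ) (x : Fin n → Fin m → ℝ) (b : Fin m → ℝ) : ℝ :=
  ∏ s : Fin (n / K), b ⬝ᵥ x ⟨K * (s : ℕ) + n % K, past_index_lt s⟩

/-- The proposed learning strategy with cycle length `K` and density `ρ`: the uniform portfolio in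
the first `K` periods, and afterwards the average of the portfolios `b` weighted by their wealth
on the subsequence of past periods at the same position in the cycle. -/
def learningStrategy (m K : ℕ) (ρ : (Fin m → ℝ) → ℝ) : Strategy m :=
  fun n x j =>
    if n < K then 1 / (m : ℝ)
    else (∫ b, b j * subsequenceWealth K n x b * ρ b ∂(simplexVolume m)) /
      (∫ b, subsequenceWealth K n x b * ρ b ∂(simplexVolume m))

section Probability

variable {Ω : Type*} [MeasurableSpace Ω]

/-- The `t`-th block of length `k` of the process `X`. -/
def block {m : ℕ} (k : ℕ) (X : ℕ → Ω → Fin m → ℝ) (t : ℕ) : Ω → Fin k → Fin m → ℝ :=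
  fun ω i => X (k * t + (i : ℕ)) ω

/-- The consecutive blocks of length `k` are independent and identically distributed. -/
def IsBlockIID {m : ℕ} (P : Measure Ω) (k : ℕ) (X : ℕ → Ω → Fin m → ℝ) : Prop :=
  iIndepFun (block k X) P ∧ ∀ t, IdentDistrib (block k X t) (block k X 0) P P

/-- The expectation of `Y` exists in `[-∞, ∞]`: its positive and negative parts do not both have
infinite expectation. -/
def HasExpectation (P : Measure Ω) (Y : Ω → ℝ) : Prop :=
  (∫⁻ ω, ENNReal.ofReal (Y ω) ∂P) ≠ ⊤ ∨ (∫⁻ ω, ENNReal.ofReal (-Y ω) ∂P) ≠ ⊤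

/-- The expectation in `[-∞, ∞]`, meaningful under `HasExpectation P Y`. -/
def expectation (P : Measure Ω) (Y : Ω → ℝ) : EReal :=
  ((∫⁻ ω, ENNReal.ofReal (Y ω) ∂P : ENNReal) : EReal) -
    ((∫⁻ ω, ENNReal.ofReal (-Y ω) ∂P : ENNReal) : EReal)

/-- The logarithmic return of the portfolios `b` on the `k` random return vectors `Y`. -/
def logReturn {m k : ℕ} (Y : Ω → Fin k → Fin m → ℝ) (b : Fin k → Fin m → ℝ) : Ω → ℝ :=
  fun ω => ∑ i, Real.log (b i ⬝ᵥ Y ω i)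

/-- `b` is a tuple of `k`-log-optimal portfolios for the joint law of the `k` vectors `Y`: it
maximizes the expected logarithmic return, all these expectations being well defined. -/
def IsLogOptimal {m k : ℕ} (P : Measure Ω) (Y : Ω → Fin k → Fin m → ℝ)
    (b : Fin k → Fin m → ℝ) : Prop :=
  (∀ i, b i ∈ stdSimplex ℝ (Fin m)) ∧
    ∀ c : Fin k → Fin m → ℝ, (∀ i, c i ∈ stdSimplex ℝ (Fin m)) →
      HasExpectation P (logReturn Y c) ∧
        expectation P (logReturn Y c) ≤ expectation P (logReturn Y b)

end Probability

end CyclicPortfolio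

end

noncomputable section

namespace CyclicPortfolio

/-! ### The reference measure on the simplex -/

/-! The two strategies are compared directly, without a law of large numbers for either growth rate.
Fix a residue class modulo `K = d * k`. On it the cyclic strategy always uses one portfolio `c`. The
learning strategy earns, after its first visit, quotients of consecutive values of `mixtureWealth`,
the `ν`-average `V T` of the wealths of constant portfolios; hence its wealth on the class
telescopes to `V T` up to constant factors (`exists_bounds_prod_residueReturn`).

Lower bound, valid on every path: the prior `ν` gives positive mass to the portfolios that dominate
`(1 - ε) c` componentwise, even for `c` on the boundary of the simplex. So `V T` is at least a
constant times `(1 - ε) ^ T` times the wealth of `c` (`IsPrior.le_mixtureWealth`).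

Upper bound, almost surely: by optimality the ratio of the return of any `b` to that of `c` has mean
at most `1` (`IsLogOptimal.lintegral_ratio_le_one`). Distinct periods of the class lie in distinct
blocks, hence are independent, and by Tonelli `V T` divided by the wealth of `c` has mean at most
the mass of `ν`. Summation against `1 / (T + 1) ^ 2` makes this ratio `O((T + 1) ^ 2)`
(`IsPrior.ae_exists_mixtureWealth_le`).

Multiplied over the `K` classes, the bounds make the ratio of the two wealths subexponential in both
directions, so its logarithm is `o(n)`. -/

theorem measurable_completeCoords (m : ℕ) : Measurable (completeCoords m) := by
  refine measurable_pi_iff.2 fun j => ?_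
  by_cases h : (j : ℕ) < m - 1
  · simpa [completeCoords, h] using measurable_pi_apply _
  · simp only [completeCoords, h, dite_false]
    fun_prop

theorem measurableSet_projectedSimplex (m : ℕ) : MeasurableSet (projectedSimplex m) := by
  have h1 : IsClosed {y : Fin (m - 1) → ℝ | ∀ i, 0 ≤ y i} := by
    simp only [Set.ofPred_forall]
    exact isClosed_iInter fun i => isClosed_le continuous_const (continuous_apply i)
  have h2 : IsClosed {y : Fin (m - 1) → ℝ | ∑ i, y i ≤ 1} :=
    isClosed_le (by fun_prop) continuous_const
  exact (h1.inter h2).measurableSet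

theorem completeCoords_castSucc {n : ℕ} (y : Fin n → ℝ) (i : Fin n) :
    completeCoords (n + 1) y i.castSucc = y i := by
  simp [completeCoords]

theorem completeCoords_last {n : ℕ} (y : Fin n → ℝ) :
    completeCoords (n + 1) y (Fin.last n) = 1 - ∑ i, y i := by
  simp [completeCoords]

theorem completeCoords_mem_stdSimplex {m : ℕ} (hm : 1 ≤ m) {y : Fin (m - 1) → ℝ}
    (hy : y ∈ projectedSimplex m) : completeCoords m y ∈ stdSimplex ℝ (Fin m) := by
  obtain ⟨n, rfl⟩ : ∃ n, m = n + 1 := ⟨m - 1, by omega⟩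
  refine ⟨fun j => ?_, ?_⟩
  · refine Fin.lastCases ?_ (fun i => ?_) j
    · rw [completeCoords_last]
      exact sub_nonneg.2 hy.2
    · rw [completeCoords_castSucc]
      exact hy.1 i
  · rw [Fin.sum_univ_castSucc, completeCoords_last]
    simp only [completeCoords_castSucc]
    exact add_sub_cancel _ _

theorem projectedSimplex_subset_Icc (m : ℕ) :
    projectedSimplex m ⊆ Set.Icc (0 : Fin (m - 1) → ℝ) 1 := fun _ hy =>
  ⟨hy.1, fun i => (Finset.single_le_sum (fun j _ => hy.1 j) (Finset.mem_univ i)).trans hy.2⟩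

instance isFiniteMeasure_simplexVolume (m : ℕ) : IsFiniteMeasure (simplexVolume m) := by
  have : IsFiniteMeasure ((volume : Measure (Fin (m - 1) → ℝ)).restrict (projectedSimplex m)) := by
    refine ⟨?_⟩
    rw [Measure.restrict_apply_univ]
    exact (measure_mono (projectedSimplex_subset_Icc m)).trans_lt isCompact_Icc.measure_lt_top
  unfold simplexVolume
  infer_instance

theorem measurableSet_stdSimplex (m : ℕ) : MeasurableSet (stdSimplex ℝ (Fin m)) :=
  (isClosed_stdSimplex ℝ (Fin m)).measurableSet

theorem ae_simplexVolume_mem_stdSimplex {m : ℕ} (hm : 1 ≤ m) :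
    ∀ᵐ b ∂simplexVolume m, b ∈ stdSimplex ℝ (Fin m) := by
  refine (ae_map_iff (measurable_completeCoords m).aemeasurable (measurableSet_stdSimplex m)).2 ?_
  exact (ae_restrict_mem (measurableSet_projectedSimplex m)).mono
    fun y hy => completeCoords_mem_stdSimplex hm hy

/-- The portfolios that keep more than the proportion `1 - ε` of every component of `c`. -/
def nearPortfolios {m : ℕ} (c : Fin m → ℝ) (ε : ℝ) : Set (Fin m → ℝ) :=
  {b | ∀ j, (1 - ε) * c j < b j}

theorem isOpen_nearPortfolios {m : ℕ} (c : Fin m → ℝ) (ε : ℝ) : IsOpen (nearPortfolios c ε) := by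
  simp only [nearPortfolios, Set.ofPred_forall]
  exact isOpen_iInter_of_finite fun i => isOpen_lt continuous_const (continuous_apply i)

/-- The lower bounds `(1 - ε) * c j` are nonnegative, so in the first `m - 1` coordinates the set is
already contained in the projected simplex. There it is open, and a nonempty open set has positive
Lebesgue measure. -/
theorem simplexVolume_nearPortfolios_pos {m : ℕ} (hm : 1 ≤ m) {c : Fin m → ℝ}
    (hc : c ∈ stdSimplex ℝ (Fin m)) {ε : ℝ} (hε0 : 0 < ε) (hε1 : ε < 1) :
    0 < simplexVolume m (nearPortfolios c ε) := by
  obtain ⟨n, rfl⟩ : ∃ n, m = n + 1 := ⟨m - 1, by omega⟩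
  rw [simplexVolume, Measure.map_apply (measurable_completeCoords _)
    (isOpen_nearPortfolios c ε).measurableSet,
    Measure.restrict_apply ((measurable_completeCoords _) (isOpen_nearPortfolios c ε).measurableSet)]
  have hcont : Continuous (completeCoords (n + 1)) := by
    refine continuous_pi fun j => ?_
    by_cases h : (j : ℕ) < n + 1 - 1
    · simp only [completeCoords, h, dite_true]
      fun_prop
    · simp only [completeCoords, h, dite_false]
      fun_prop
  have hsub : completeCoords (n + 1) ⁻¹' nearPortfolios c ε ⊆ projectedSimplex (n + 1) := by
    intro y hy
    have h0 : ∀ j, 0 ≤ completeCoords (n + 1) y j := fun j =>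
      (mul_nonneg (by linarith) (hc.1 j)).trans (hy j).le
    refine ⟨fun i => ?_, ?_⟩
    · have := h0 (Fin.castSucc i)
      rwa [completeCoords_castSucc] at this
    · have := h0 (Fin.last n)
      rw [completeCoords_last] at this
      exact sub_nonneg.1 this
  rw [Set.inter_eq_left.2 hsub]
  refine ((isOpen_nearPortfolios c ε).preimage hcont).measure_pos _ ?_
  have hsum : ∑ i : Fin n, c i.castSucc = 1 - c (Fin.last n) := by
    have := hc.2
    rw [Fin.sum_univ_castSucc] at this
    linarith
  -- The witness mixes `c` with weight `1 - ε` and the uniform portfolio with weight `ε`.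
  refine ⟨fun i : Fin n => (1 - ε) * c i.castSucc + ε / (n + 1), fun j => ?_⟩
  have hn : (0 : ℝ) < n + 1 := by positivity
  have he : 0 < ε / (n + 1) := by positivity
  refine Fin.lastCases ?_ (fun i => ?_) j
  · rw [completeCoords_last, Finset.sum_add_distrib, ← Finset.mul_sum, hsum]
    have : (n : ℝ) * (ε / (n + 1)) = ε - ε / (n + 1) := by field_simp; ring
    simp only [Finset.sum_const, Finset.card_univ, Fintype.card_fin, nsmul_eq_mul, this]
    linarith
  · rw [completeCoords_castSucc]
    linarith

/-! ### Integrability of the densities -/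

/-- One of `u` and `s - u` is at least `s / 2`, which bounds its factor. For `s = 0` both sides
vanish because `0 ^ (-1/2) = 0` in Lean. -/
theorem rpow_neg_half_mul_le {s u : ℝ} (hu : 0 ≤ u) (hus : u ≤ s) :
    u ^ (-(1 / 2) : ℝ) * (s - u) ^ (-(1 / 2) : ℝ) ≤
      (s / 2) ^ (-(1 / 2) : ℝ) * (u ^ (-(1 / 2) : ℝ) + (s - u) ^ (-(1 / 2) : ℝ)) := by
  have hs : 0 ≤ s := hu.trans hus
  rcases hs.eq_or_lt with rfl | hs
  · obtain rfl : u = 0 := le_antisymm hus hu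
    norm_num
  have h1 : 0 ≤ u ^ (-(1 / 2) : ℝ) := Real.rpow_nonneg hu _
  have h2 : 0 ≤ (s - u) ^ (-(1 / 2) : ℝ) := Real.rpow_nonneg (by linarith) _
  have h3 : 0 ≤ (s / 2) ^ (-(1 / 2) : ℝ) := Real.rpow_nonneg (by linarith) _
  rcases le_total u (s / 2) with h | h
  · have h4 : (s - u) ^ (-(1 / 2) : ℝ) ≤ (s / 2) ^ (-(1 / 2) : ℝ) :=
      Real.rpow_le_rpow_of_nonpos (by linarith) (by linarith) (by norm_num)
    nlinarith [mul_le_mul_of_nonneg_left h4 h1, mul_nonneg h3 h2]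
  · have h4 : u ^ (-(1 / 2) : ℝ) ≤ (s / 2) ^ (-(1 / 2) : ℝ) :=
      Real.rpow_le_rpow_of_nonpos (by linarith) (by linarith) (by norm_num)
    nlinarith [mul_le_mul_of_nonneg_right h4 h2, mul_nonneg h3 h1]

/-- The integrals of `u ↦ u ^ (-1/2) * (s - u) ^ (-1/2)` over `[0, s]` are bounded in `s`. -/
theorem lintegral_rpow_neg_half_mul_le (s : ℝ) :
    ∫⁻ u in Set.Icc 0 s, ENNReal.ofReal (u ^ (-(1 / 2) : ℝ) * (s - u) ^ (-(1 / 2) : ℝ)) ≤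
      ENNReal.ofReal (4 * 2 ^ (1 / 2 : ℝ)) := by
  rcases le_or_gt s 0 with hs | hs
  · have : volume (Set.Icc 0 s) = 0 := by simp [hs]
    rw [Measure.restrict_eq_zero.2 this]
    simp
  have hi1 : IntervalIntegrable (fun u : ℝ => u ^ (-(1 / 2) : ℝ)) volume 0 s :=
    intervalIntegral.intervalIntegrable_rpow' (by norm_num)
  have hi2 : IntervalIntegrable (fun u : ℝ => (s - u) ^ (-(1 / 2) : ℝ)) volume 0 s := by
    have := (hi1.comp_sub_left s).symm
    simpa using this
  have hI : ∫ u in (0 : ℝ)..s, u ^ (-(1 / 2) : ℝ) = 2 * s ^ (1 / 2 : ℝ) := by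
    rw [integral_rpow (Or.inl (by norm_num))]
    norm_num
    ring
  have hI2 : ∫ u in (0 : ℝ)..s, (s - u) ^ (-(1 / 2) : ℝ) = 2 * s ^ (1 / 2 : ℝ) := by
    rw [intervalIntegral.integral_comp_sub_left (fun u : ℝ => u ^ (-(1 / 2) : ℝ)) s]
    simpa using hI
  have hint : IntervalIntegrable (fun u : ℝ => (s / 2) ^ (-(1 / 2) : ℝ) *
      (u ^ (-(1 / 2) : ℝ) + (s - u) ^ (-(1 / 2) : ℝ))) volume 0 s := (hi1.add hi2).const_mul _
  calc ∫⁻ u in Set.Icc 0 s, ENNReal.ofReal (u ^ (-(1 / 2) : ℝ) * (s - u) ^ (-(1 / 2) : ℝ))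
      ≤ ∫⁻ u in Set.Icc 0 s, ENNReal.ofReal ((s / 2) ^ (-(1 / 2) : ℝ) *
          (u ^ (-(1 / 2) : ℝ) + (s - u) ^ (-(1 / 2) : ℝ))) :=
        setLIntegral_mono' measurableSet_Icc fun u hu =>
          ENNReal.ofReal_le_ofReal (rpow_neg_half_mul_le hu.1 hu.2)
    _ = ENNReal.ofReal (∫ u in (0 : ℝ)..s, (s / 2) ^ (-(1 / 2) : ℝ) *
          (u ^ (-(1 / 2) : ℝ) + (s - u) ^ (-(1 / 2) : ℝ))) := by
        rw [intervalIntegral.integral_of_le hs.le, ← integral_Icc_eq_integral_Ioc,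
          ofReal_integral_eq_lintegral_ofReal]
        · exact (integrableOn_Icc_iff_integrableOn_Ioc enorm_ne_top).2 hint.1
        · filter_upwards [ae_restrict_mem measurableSet_Icc] with u hu
          have h1 : 0 ≤ u ^ (-(1 / 2) : ℝ) := Real.rpow_nonneg hu.1 _
          have h2 : 0 ≤ (s - u) ^ (-(1 / 2) : ℝ) := Real.rpow_nonneg (sub_nonneg.2 hu.2) _
          have h3 : 0 ≤ (s / 2) ^ (-(1 / 2) : ℝ) := Real.rpow_nonneg (by linarith) _
          exact mul_nonneg h3 (add_nonneg h1 h2)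
    -- The two integrals sum to `4 * s ^ (1/2)`, and the prefactor `(s / 2) ^ (-1/2)` cancels the
    -- dependence on `s`.
    _ = ENNReal.ofReal (4 * 2 ^ (1 / 2 : ℝ)) := by
        congr 1
        rw [intervalIntegral.integral_const_mul, intervalIntegral.integral_add hi1 hi2, hI, hI2,
          Real.div_rpow hs.le (by norm_num), Real.rpow_neg hs.le, Real.rpow_neg (by norm_num)]
        have : s ^ (1 / 2 : ℝ) ≠ 0 := (Real.rpow_pos_of_pos hs _).ne'
        field_simp
        ring

/-- The function `u ↦ u ^ (-1/2)` on `[0, 1]`, extended by zero. -/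
def rpowNegHalfIcc (u : ℝ) : ℝ := (Set.Icc (0 : ℝ) 1).indicator (fun u => u ^ (-(1 / 2) : ℝ)) u

theorem integrable_rpowNegHalfIcc : Integrable rpowNegHalfIcc := by
  have h : IntervalIntegrable (fun u : ℝ => u ^ (-(1 / 2) : ℝ)) volume 0 1 :=
    intervalIntegral.intervalIntegrable_rpow' (by norm_num)
  unfold rpowNegHalfIcc
  rw [integrable_indicator_iff measurableSet_Icc, integrableOn_Icc_iff_integrableOn_Ioc (by simp)]
  exact h.1

theorem measurable_prod_rpow_neg_half (m : ℕ) :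
    Measurable fun b : Fin m → ℝ => ∏ j, b j ^ (-(1 / 2) : ℝ) :=
  Finset.measurable_prod _ fun j _ => (measurable_pi_apply j).pow_const _

/-- The integral over one free coordinate `u`, paired with the dependent last coordinate, is bounded
uniformly in the remaining `z`. What is left is a product of integrable functions of one variable on
`[0, 1]`. -/
theorem lintegral_prod_rpow_neg_half_lt_top {m : ℕ} (hm : 2 ≤ m) :
    ∫⁻ b, ENNReal.ofReal (∏ j, b j ^ (-(1 / 2) : ℝ)) ∂simplexVolume m < ⊤ := by
  obtain ⟨n, rfl⟩ : ∃ n, m = n + 1 + 1 := ⟨m - 2, by omega⟩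
  rw [simplexVolume, lintegral_map (measurable_prod_rpow_neg_half _).ennreal_ofReal
    (measurable_completeCoords _), ← lintegral_indicator (measurableSet_projectedSimplex _)]
  set C : ENNReal := ENNReal.ofReal (4 * 2 ^ (1 / 2 : ℝ)) with hC
  -- A majorant on the whole space: `z` is only confined to the cube, while `u` keeps its exact
  -- range, which is empty when `∑ z > 1`.
  let ψ : ℝ → (Fin n → ℝ) → ENNReal := fun u z =>
    ENNReal.ofReal (∏ i, rpowNegHalfIcc (z i)) *
      (Set.Icc 0 (1 - ∑ i, z i)).indicator (fun u =>
        ENNReal.ofReal (u ^ (-(1 / 2) : ℝ) * ((1 - ∑ i, z i) - u) ^ (-(1 / 2) : ℝ))) u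
  have hmeas : Measurable fun p : ℝ × (Fin n → ℝ) => ψ p.1 p.2 := by
    refine Measurable.mul ?_ ?_
    · refine (Finset.measurable_prod _ fun i _ => ?_).ennreal_ofReal
      have hφ : Measurable rpowNegHalfIcc :=
        (measurable_id.pow_const _).indicator measurableSet_Icc
      exact hφ.comp (by fun_prop)
    · have hset : MeasurableSet {p : ℝ × (Fin n → ℝ) | 0 ≤ p.1 ∧ p.1 ≤ 1 - ∑ i, p.2 i} :=
        (measurableSet_le measurable_const measurable_fst).inter
          (measurableSet_le measurable_fst (by fun_prop))
      have hf : Measurable fun p : ℝ × (Fin n → ℝ) => ENNReal.ofReal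
          (p.1 ^ (-(1 / 2) : ℝ) * ((1 - ∑ i, p.2 i) - p.1) ^ (-(1 / 2) : ℝ)) := by
        refine (Measurable.mul (measurable_fst.pow_const _) ?_).ennreal_ofReal
        exact Measurable.pow_const (by fun_prop) _
      exact hf.indicator hset
  have hle : ∀ y : Fin (n + 1) → ℝ,
      (projectedSimplex (n + 1 + 1)).indicator (fun y => ENNReal.ofReal
        (∏ j, completeCoords (n + 1 + 1) y j ^ (-(1 / 2) : ℝ))) y ≤
      ψ (y 0) (fun i => y i.succ) := by
    intro y
    by_cases hy : y ∈ projectedSimplex (n + 1 + 1)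
    swap
    · rw [Set.indicator_of_notMem hy]
      exact zero_le
    rw [Set.indicator_of_mem hy]
    have hsum : ∑ i, y i = y 0 + ∑ i : Fin n, y i.succ := Fin.sum_univ_succ y
    have hle1 : ∑ i, y i ≤ 1 := hy.2
    have hmem : y 0 ∈ Set.Icc 0 (1 - ∑ i : Fin n, y i.succ) :=
      ⟨hy.1 (0 : Fin (n + 1)), by linarith⟩
    have hφ : ∀ i : Fin n, rpowNegHalfIcc (y i.succ) = y i.succ ^ (-(1 / 2) : ℝ) := fun i =>
      Set.indicator_of_mem (show y i.succ ∈ Set.Icc (0 : ℝ) 1 from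
        ⟨(projectedSimplex_subset_Icc _ hy).1 i.succ, (projectedSimplex_subset_Icc _ hy).2 i.succ⟩) _
    simp only [ψ, Set.indicator_of_mem hmem, hφ]
    rw [← ENNReal.ofReal_mul (Finset.prod_nonneg fun i _ => Real.rpow_nonneg (hy.1 i.succ) _)]
    refine ENNReal.ofReal_le_ofReal (le_of_eq ?_)
    rw [Fin.prod_univ_castSucc, completeCoords_last]
    simp only [completeCoords_castSucc]
    rw [Fin.prod_univ_succ, show (1 : ℝ) - ∑ i, y i = 1 - ∑ i : Fin n, y i.succ - y 0 by linarith]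
    ring
  have hmp := volume_preserving_piFinSuccAbove (fun _ : Fin (n + 1) => ℝ) 0
  calc _ ≤ ∫⁻ y : Fin (n + 1) → ℝ, ψ (y 0) (fun i => y i.succ) := lintegral_mono hle
    _ = ∫⁻ p : ℝ × (Fin n → ℝ), ψ p.1 p.2 := by
        rw [← hmp.lintegral_comp hmeas]
        rfl
    _ = ∫⁻ z : Fin n → ℝ, ∫⁻ u : ℝ, ψ u z := by
        rw [Measure.volume_eq_prod, lintegral_prod_symm _ hmeas.aemeasurable]
    _ ≤ ∫⁻ z : Fin n → ℝ, ENNReal.ofReal (∏ i, rpowNegHalfIcc (z i)) * C := by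
        refine lintegral_mono fun z => ?_
        simp only [ψ]
        rw [lintegral_const_mul' _ _ ENNReal.ofReal_ne_top, lintegral_indicator measurableSet_Icc]
        gcongr
        exact lintegral_rpow_neg_half_mul_le _
    _ < ⊤ := by
        rw [lintegral_mul_const' _ _ ENNReal.ofReal_ne_top]
        refine ENNReal.mul_lt_top ?_ ENNReal.ofReal_lt_top
        have : Integrable (fun z : Fin n → ℝ => ∏ i, rpowNegHalfIcc (z i)) :=
          Integrable.fintype_prod fun _ => integrable_rpowNegHalfIcc
        exact this.lintegral_lt_top

/-! ### Priors on the simplex -/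

/-- A finite measure on the simplex that charges the neighbourhoods `nearPortfolios c ε`. -/
structure IsPrior {m : ℕ} (ν : Measure (Fin m → ℝ)) : Prop where
  finite : IsFiniteMeasure ν
  ae_mem : ∀ᵐ b ∂ν, b ∈ stdSimplex ℝ (Fin m)
  near_pos : ∀ c ∈ stdSimplex ℝ (Fin m), ∀ ε : ℝ, 0 < ε → ε < 1 → 0 < ν (nearPortfolios c ε)

/-- The measure on the simplex with density `ρ`. -/
def densityMeasure (m : ℕ) (ρ : (Fin m → ℝ) → ℝ) : Measure (Fin m → ℝ) :=
  (simplexVolume m).withDensity fun b => ENNReal.ofReal (ρ b)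

/-- Positivity of `ρ` is needed only at interior points, since every point of `nearPortfolios c ε`
has positive coordinates. The values of the Dirichlet density on the boundary are therefore
irrelevant here. -/
theorem isPrior_densityMeasure {m : ℕ} (hm : 1 ≤ m) {ρ : (Fin m → ℝ) → ℝ} (hρ : Measurable ρ)
    (hpos : ∀ b, (∀ j, 0 < b j) → 0 < ρ b)
    (hfin : ∫⁻ b, ENNReal.ofReal (ρ b) ∂simplexVolume m < ⊤) : IsPrior (densityMeasure m ρ) where
  finite := isFiniteMeasure_withDensity hfin.ne
  ae_mem := withDensity_absolutelyContinuous _ _ (ae_simplexVolume_mem_stdSimplex hm)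
  near_pos c hc ε hε0 hε1 := by
    rw [pos_iff_ne_zero, densityMeasure, Ne, withDensity_apply_eq_zero hρ.ennreal_ofReal]
    have : nearPortfolios c ε ⊆ {b | ENNReal.ofReal (ρ b) ≠ 0} := fun b hb => by
      have : 0 < ρ b := hpos b fun j => (mul_nonneg (by linarith) (hc.1 j)).trans_lt (hb j)
      simpa using this
    rw [Set.inter_eq_right.2 this]
    exact (simplexVolume_nearPortfolios_pos hm hc hε0 hε1).ne'

theorem integral_densityMeasure {m : ℕ} (hm : 1 ≤ m) {ρ : (Fin m → ℝ) → ℝ} (hρ : Measurable ρ)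
    (hnonneg : ∀ b ∈ stdSimplex ℝ (Fin m), 0 ≤ ρ b) (f : (Fin m → ℝ) → ℝ) :
    ∫ b, f b * ρ b ∂simplexVolume m = ∫ b, f b ∂densityMeasure m ρ := by
  rw [densityMeasure, integral_withDensity_eq_integral_toReal_smul hρ.ennreal_ofReal
    (by simp)]
  refine integral_congr_ae ?_
  filter_upwards [ae_simplexVolume_mem_stdSimplex hm] with b hb
  rw [ENNReal.toReal_ofReal (hnonneg b hb), smul_eq_mul, mul_comm]

theorem density_properties {m : ℕ} (hm : 2 ≤ m) {ρ : (Fin m → ℝ) → ℝ}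
    (hρ : ρ = uniformDensity m ∨ ρ = dirichletDensity m (1 / 2)) :
    Measurable ρ ∧ (∀ b, (∀ j, 0 < b j) → 0 < ρ b) ∧ (∀ b ∈ stdSimplex ℝ (Fin m), 0 ≤ ρ b) ∧
      ∫⁻ b, ENNReal.ofReal (ρ b) ∂simplexVolume m < ⊤ := by
  rcases hρ with rfl | rfl
  · refine ⟨measurable_const, fun _ _ => ?_, fun _ _ => ?_, ?_⟩
    · exact Nat.cast_pos.2 (Nat.factorial_pos _)
    · exact Nat.cast_nonneg _
    · simp only [uniformDensity, lintegral_const]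
      exact ENNReal.mul_lt_top ENNReal.ofReal_lt_top (measure_lt_top _ _)
  · have hG : 0 < Real.Gamma (m * (1 / 2)) / Real.Gamma (1 / 2) ^ m := by
      have : (0 : ℝ) < m := by exact_mod_cast (by omega : 0 < m)
      have h1 := Real.Gamma_pos_of_pos (by positivity : (0 : ℝ) < m * (1 / 2))
      have h2 := Real.Gamma_pos_of_pos (by norm_num : (0 : ℝ) < 1 / 2)
      positivity
    have he : (1 / 2 - 1 : ℝ) = -(1 / 2) := by norm_num
    have hd : dirichletDensity m (1 / 2) = fun b =>
        Real.Gamma (m * (1 / 2)) / Real.Gamma (1 / 2) ^ m * ∏ j, b j ^ (-(1 / 2) : ℝ) := by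
      funext b
      simp only [dirichletDensity, he]
    rw [hd]
    refine ⟨(measurable_prod_rpow_neg_half m).const_mul _, fun b hb => ?_, fun b hb => ?_, ?_⟩
    · exact mul_pos hG (Finset.prod_pos fun j _ => Real.rpow_pos_of_pos (hb j) _)
    · exact mul_nonneg hG.le (Finset.prod_nonneg fun j _ => Real.rpow_nonneg (hb.1 j) _)
    · simp only [ENNReal.ofReal_mul hG.le]
      rw [lintegral_const_mul' _ _ ENNReal.ofReal_ne_top]
      exact ENNReal.mul_lt_top ENNReal.ofReal_lt_top (lintegral_prod_rpow_neg_half_lt_top hm)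

/-! ### Optimality conditions -/

section Optimality

variable {Ω : Type*} [MeasurableSpace Ω] {P : Measure Ω}

theorem expectation_eq_integral {Y : Ω → ℝ} (hY : Integrable Y P) :
    expectation P Y = ((∫ ω, Y ω ∂P : ℝ) : EReal) := by
  have h1 : ∫⁻ ω, ENNReal.ofReal (Y ω) ∂P ≠ ⊤ := hY.lintegral_lt_top.ne
  have h2 : ∫⁻ ω, ENNReal.ofReal (-Y ω) ∂P ≠ ⊤ := hY.neg.lintegral_lt_top.ne
  rw [integral_eq_lintegral_pos_part_sub_lintegral_neg_part hY, EReal.coe_sub,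
    EReal.coe_ennreal_toReal h1, EReal.coe_ennreal_toReal h2, expectation]

/-- A perturbation bounded below does not increase a finite maximal expectation, hence it is
integrable with nonpositive mean. -/
theorem integrable_and_integral_nonpos_of_expectation_add_le [IsFiniteMeasure P] {L D : Ω → ℝ}
    (hL : Integrable L P) (hD : AEStronglyMeasurable D P) {a : ℝ} (ha : ∀ ω, a ≤ D ω)
    (hle : expectation P (fun ω => L ω + D ω) ≤ expectation P L) :
    Integrable D P ∧ ∫ ω, D ω ∂P ≤ 0 := by
  have hlow : Integrable (fun ω => |L ω| + |a|) P := hL.abs.add (integrable_const _)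
  have hneg : ∫⁻ ω, ENNReal.ofReal (-(L ω + D ω)) ∂P ≠ ⊤ := by
    refine ((lintegral_mono fun ω => ENNReal.ofReal_le_ofReal ?_).trans_lt
      hlow.lintegral_lt_top).ne
    have := ha ω
    have := neg_abs_le a
    have := neg_abs_le (L ω)
    linarith
  -- Otherwise the perturbed expectation would be `⊤`, its negative part being finite, against the
  -- finite maximum.
  have hposfin : ∫⁻ ω, ENNReal.ofReal (L ω + D ω) ∂P ≠ ⊤ := by
    intro htop
    rw [expectation_eq_integral hL, expectation, htop, ← EReal.coe_ennreal_toReal hneg,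
      EReal.coe_ennreal_top, EReal.top_sub_coe, top_le_iff] at hle
    exact EReal.coe_ne_top _ hle
  have hint : Integrable (fun ω => L ω + D ω) P := by
    refine ⟨hL.aestronglyMeasurable.add hD, ?_⟩
    rw [hasFiniteIntegral_iff_norm]
    have : ∀ ω, ENNReal.ofReal ‖L ω + D ω‖ ≤
        ENNReal.ofReal (L ω + D ω) + ENNReal.ofReal (-(L ω + D ω)) := fun ω => by
      rcases le_total 0 (L ω + D ω) with h | h
      · rw [Real.norm_of_nonneg h]
        exact le_self_add
      · rw [Real.norm_of_nonpos h]
        exact le_add_self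
    refine (lintegral_mono this).trans_lt ?_
    have hm : AEMeasurable (fun ω => L ω + D ω) P := hL.aemeasurable.add hD.aemeasurable
    rw [lintegral_add_left' hm.ennreal_ofReal]
    exact ENNReal.add_lt_top.2 ⟨hposfin.lt_top, hneg.lt_top⟩
  have hDint : Integrable D P := by
    have := hint.sub hL
    refine this.congr (ae_of_all _ fun ω => ?_)
    simp
  refine ⟨hDint, ?_⟩
  rw [expectation_eq_integral hL, expectation_eq_integral hint, EReal.coe_le_coe_iff,
    integral_add hL hDint] at hle
  linarith

/-- If `log (1 - t + t R)` has nonpositive mean for all `t`, then `R` has mean at most `1`. -/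
theorem lintegral_le_one_of_integral_log_nonpos [IsProbabilityMeasure P] {R : Ω → ℝ}
    (hR : Measurable R) (hR0 : ∀ ω, 0 ≤ R ω)
    (h : ∀ t : ℝ, 0 < t → t < 1 → Integrable (fun ω => Real.log (1 - t + t * R ω)) P ∧
      ∫ ω, Real.log (1 - t + t * R ω) ∂P ≤ 0) :
    ∫⁻ ω, ENNReal.ofReal (R ω) ∂P ≤ 1 := by
  let t : ℕ → ℝ := fun n => 1 / ((n : ℝ) + 2)
  have ht0 : ∀ n, 0 < t n := fun n => by positivity
  have ht1 : ∀ n, t n ≤ 1 / 2 := fun n =>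
    one_div_le_one_div_of_le (by norm_num) (by have := n.cast_nonneg (α := ℝ); linarith)
  have htlim : Tendsto t atTop (𝓝 0) := by
    have := (tendsto_const_div_atTop_nhds_zero_nat (1 : ℝ)).comp (tendsto_add_atTop_nat 2)
    refine this.congr fun n => ?_
    simp [t]
  have hbase : ∀ n ω, 1 - t n ≤ 1 - t n + t n * R ω := fun n ω => by
    have := mul_nonneg (ht0 n).le (hR0 ω)
    linarith
  -- Difference quotients at `0` of `s ↦ log (1 - s + s R)`, which tend to `R - 1`. Since `log (1 -
  -- t) ≥ -2 t` for `t ≤ 1/2`, adding `2` makes them nonnegative, as Fatou's lemma requires.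
  let f : ℕ → Ω → ℝ := fun n ω => Real.log (1 - t n + t n * R ω) / t n + 2
  have hf0 : ∀ n ω, 0 ≤ f n ω := fun n ω => by
    have h1 := ht1 n
    have h0 := ht0 n
    have hlog : -2 * t n ≤ Real.log (1 - t n + t n * R ω) := by
      refine le_trans ?_ (Real.log_le_log (by linarith) (hbase n ω))
      refine le_trans ?_ (Real.one_sub_inv_le_log_of_pos (by linarith))
      have : (1 - t n)⁻¹ ≤ 1 + 2 * t n := by
        rw [inv_le_iff_one_le_mul₀ (by linarith)]
        nlinarith
      linarith
    have : -2 ≤ Real.log (1 - t n + t n * R ω) / t n := (le_div_iff₀ h0).2 hlog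
    simp only [f]
    linarith
  have hfm : ∀ n, Measurable (f n) := fun n =>
    ((Real.measurable_log.comp ((hR.const_mul _).const_add _)).div_const _).add_const _
  have hint : ∀ n, ∫⁻ ω, ENNReal.ofReal (f n ω) ∂P ≤ 2 := fun n => by
    obtain ⟨hi, hle⟩ := h (t n) (ht0 n) (by linarith [ht1 n])
    have hfi : Integrable (f n) P := (hi.div_const _).add (integrable_const _)
    rw [← ofReal_integral_eq_lintegral_ofReal hfi (ae_of_all _ (hf0 n)), integral_add (hi.div_const _) (integrable_const _), integral_div]
    refine ENNReal.ofReal_le_of_le_toReal ?_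
    have := div_nonpos_of_nonpos_of_nonneg hle (ht0 n).le
    simp only [integral_const, probReal_univ, smul_eq_mul, ENNReal.toReal_ofNat]
    linarith
  have hlim : ∀ ω, Tendsto (fun n => f n ω) atTop (𝓝 (R ω + 1)) := fun ω => by
    have hd : HasDerivAt (fun s : ℝ => Real.log (1 - s + s * R ω)) (R ω - 1) 0 := by
      have h1 : HasDerivAt (fun s : ℝ => 1 - s + s * R ω) (-1 + 1 * R ω) 0 :=
        ((hasDerivAt_id (0 : ℝ)).const_sub 1).add ((hasDerivAt_id (0 : ℝ)).mul_const (R ω))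
      have h2 := h1.log (by norm_num)
      convert h2 using 1
      norm_num
      ring
    have hs := hd.tendsto_slope_zero
    have ht : Tendsto t atTop (𝓝[≠] 0) :=
      tendsto_nhdsWithin_iff.2 ⟨htlim, Eventually.of_forall fun n => (ht0 n).ne'⟩
    have := (hs.comp ht).add_const 2
    refine (this.congr fun n => ?_).trans_eq ?_
    · simp [f, div_eq_inv_mul]
    · congr 1
      ring
  have hfatou : ∫⁻ ω, ENNReal.ofReal (R ω + 1) ∂P ≤ 2 := by
    calc ∫⁻ ω, ENNReal.ofReal (R ω + 1) ∂P
        = ∫⁻ ω, liminf (fun n => ENNReal.ofReal (f n ω)) atTop ∂P := by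
          refine lintegral_congr fun ω => ?_
          exact ((ENNReal.continuous_ofReal.tendsto _).comp (hlim ω)).liminf_eq.symm
      _ ≤ liminf (fun n => ∫⁻ ω, ENNReal.ofReal (f n ω) ∂P) atTop :=
          lintegral_liminf_le fun n => (hfm n).ennreal_ofReal
      _ ≤ 2 := liminf_le_of_le (by isBoundedDefault) fun b hb => by
          obtain ⟨n, hn⟩ := hb.exists
          exact hn.trans (hint n)
  have hsplit : ∫⁻ ω, ENNReal.ofReal (R ω + 1) ∂P = ∫⁻ ω, ENNReal.ofReal (R ω) ∂P + 1 := by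
    simp only [ENNReal.ofReal_add (hR0 _) zero_le_one, ENNReal.ofReal_one]
    rw [lintegral_add_right _ measurable_const]
    simp
  rw [hsplit, ← one_add_one_eq_two] at hfatou
  exact (ENNReal.add_le_add_iff_right ENNReal.one_ne_top).1 hfatou

theorem dotProduct_pos_of_mem_stdSimplex {m : ℕ} {b x : Fin m → ℝ}
    (hb : b ∈ stdSimplex ℝ (Fin m)) (hx : ∀ j, 0 < x j) : 0 < b ⬝ᵥ x := by
  have hne : ∃ j, 0 < b j := by
    by_contra! hle
    have h0 : ∑ j, b j ≤ 0 := Finset.sum_nonpos fun j _ => hle j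
    rw [hb.2] at h0
    exact absurd h0 (by norm_num)
  obtain ⟨j, hj⟩ := hne
  exact Finset.sum_pos' (fun i _ => mul_nonneg (hb.1 i) (hx i).le)
    ⟨j, Finset.mem_univ j, mul_pos hj (hx j)⟩

/-- The Kuhn-Tucker conditions for log-optimal portfolios. -/
theorem IsLogOptimal.lintegral_ratio_le_one [IsProbabilityMeasure P] {m k : ℕ}
    {Y : Ω → Fin k → Fin m → ℝ} (hY : Measurable Y) (hpos : ∀ ω i j, 0 < Y ω i j)
    {bstar : Fin k → Fin m → ℝ} (hopt : IsLogOptimal P Y bstar)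
    (hfin : Integrable (logReturn Y bstar) P) (i : Fin k) {b : Fin m → ℝ}
    (hb : b ∈ stdSimplex ℝ (Fin m)) :
    ∫⁻ ω, ENNReal.ofReal ((b ⬝ᵥ Y ω i) / (bstar i ⬝ᵥ Y ω i)) ∂P ≤ 1 := by
  have hp : ∀ ω, 0 < b ⬝ᵥ Y ω i := fun ω => dotProduct_pos_of_mem_stdSimplex hb (hpos ω i)
  have hq : ∀ ω l, 0 < bstar l ⬝ᵥ Y ω l := fun ω l =>
    dotProduct_pos_of_mem_stdSimplex (hopt.1 l) (hpos ω l)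
  have hmeas : ∀ c : Fin m → ℝ, Measurable fun ω => c ⬝ᵥ Y ω i := fun c => by
    simp only [dotProduct]
    fun_prop
  have hR : Measurable fun ω => (b ⬝ᵥ Y ω i) / (bstar i ⬝ᵥ Y ω i) := (hmeas b).div (hmeas _)
  have hR0 : ∀ ω, 0 ≤ (b ⬝ᵥ Y ω i) / (bstar i ⬝ᵥ Y ω i) := fun ω =>
    (div_pos (hp ω) (hq ω i)).le
  refine lintegral_le_one_of_integral_log_nonpos hR hR0 fun t ht0 ht1 => ?_
  -- Only the `i`-th portfolio is moved towards `b`, so the logarithmic return changes exactly by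
  -- `log (1 - t + t R)` with `R` the ratio of returns.
  let c : Fin k → Fin m → ℝ := Function.update bstar i ((1 - t) • bstar i + t • b)
  have hc : ∀ l, c l ∈ stdSimplex ℝ (Fin m) := fun l => by
    by_cases hl : l = i
    · subst hl
      simp only [c, Function.update_self]
      exact convex_stdSimplex ℝ (Fin m) (hopt.1 l) hb (by linarith) ht0.le (by ring)
    · simp only [c, Function.update_of_ne hl]
      exact hopt.1 l
  have hlog : logReturn Y c = fun ω => logReturn Y bstar ω +
      Real.log (1 - t + t * ((b ⬝ᵥ Y ω i) / (bstar i ⬝ᵥ Y ω i))) := by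
    funext ω
    have hq0 := hq ω i
    have hmix : (1 - t) * (bstar i ⬝ᵥ Y ω i) + t * (b ⬝ᵥ Y ω i) =
        (bstar i ⬝ᵥ Y ω i) * (1 - t + t * ((b ⬝ᵥ Y ω i) / (bstar i ⬝ᵥ Y ω i))) := by
      field_simp
    have hfac : 0 < 1 - t + t * ((b ⬝ᵥ Y ω i) / (bstar i ⬝ᵥ Y ω i)) := by
      have := mul_nonneg ht0.le (hR0 ω)
      linarith
    simp only [logReturn]
    rw [← Finset.add_sum_erase _ _ (Finset.mem_univ i),
      ← Finset.add_sum_erase _ (fun l => Real.log (bstar l ⬝ᵥ Y ω l)) (Finset.mem_univ i)]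
    have herase : ∑ l ∈ Finset.univ.erase i, Real.log (c l ⬝ᵥ Y ω l) =
        ∑ l ∈ Finset.univ.erase i, Real.log (bstar l ⬝ᵥ Y ω l) := by
      refine Finset.sum_congr rfl fun l hl => ?_
      simp only [c, Function.update_of_ne (Finset.ne_of_mem_erase hl)]
    rw [herase]
    simp only [c, Function.update_self, add_dotProduct, smul_dotProduct, smul_eq_mul]
    rw [hmix, Real.log_mul hq0.ne' hfac.ne']
    ring
  refine integrable_and_integral_nonpos_of_expectation_add_le hfin
    (Real.measurable_log.comp ((hR.const_mul t).const_add (1 - t))).aestronglyMeasurable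
    (a := Real.log (1 - t)) (fun ω => ?_) ?_
  · refine Real.log_le_log (by linarith) ?_
    have := mul_nonneg ht0.le (hR0 ω)
    linarith
  · rw [← hlog]
    exact (hopt.2 c hc).2

end Optimality

/-! ### The wealth of a mixture of constant portfolios -/

section Mixture

variable {m : ℕ} {ν : Measure (Fin m → ℝ)}

/-- The average over `ν` of the wealth after `T` periods of the constant portfolios. -/
def mixtureWealth (ν : Measure (Fin m → ℝ)) (z : ℕ → Fin m → ℝ) (T : ℕ) : ℝ :=
  ∫ b, ∏ s ∈ Finset.range T, b ⬝ᵥ z s ∂ν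

theorem continuous_constantWealth (z : ℕ → Fin m → ℝ) (T : ℕ) :
    Continuous fun b : Fin m → ℝ => ∏ s ∈ Finset.range T, b ⬝ᵥ z s := by
  simp only [dotProduct]
  fun_prop

theorem component_le_one {b : Fin m → ℝ} (hb : b ∈ stdSimplex ℝ (Fin m)) (j : Fin m) : b j ≤ 1 :=
  hb.2 ▸ Finset.single_le_sum (fun i _ => hb.1 i) (Finset.mem_univ j)

theorem abs_constantWealth_le {z : ℕ → Fin m → ℝ} (hz : ∀ s j, 0 < z s j) {b : Fin m → ℝ}
    (hb : b ∈ stdSimplex ℝ (Fin m)) (T : ℕ) :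
    |∏ s ∈ Finset.range T, b ⬝ᵥ z s| ≤ ∏ s ∈ Finset.range T, ∑ j, z s j := by
  rw [abs_of_pos (Finset.prod_pos fun s _ => dotProduct_pos_of_mem_stdSimplex hb (hz s))]
  refine Finset.prod_le_prod (fun s _ => (dotProduct_pos_of_mem_stdSimplex hb (hz s)).le)
    fun s _ => Finset.sum_le_sum fun j _ => ?_
  exact mul_le_of_le_one_left (hz s j).le (component_le_one hb j)

theorem IsPrior.integrable_constantWealth (hν : IsPrior ν) {z : ℕ → Fin m → ℝ}
    (hz : ∀ s j, 0 < z s j) (T : ℕ) :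
    Integrable (fun b : Fin m → ℝ => ∏ s ∈ Finset.range T, b ⬝ᵥ z s) ν := by
  have := hν.finite
  refine Integrable.of_bound (continuous_constantWealth z T).aestronglyMeasurable
    (∏ s ∈ Finset.range T, ∑ j, z s j) ?_
  filter_upwards [hν.ae_mem] with b hb
  exact abs_constantWealth_le hz hb T

theorem IsPrior.integrable_component_mul_constantWealth (hν : IsPrior ν) {z : ℕ → Fin m → ℝ}
    (hz : ∀ s j, 0 < z s j) (T : ℕ) (j : Fin m) :
    Integrable (fun b : Fin m → ℝ => b j * ∏ s ∈ Finset.range T, b ⬝ᵥ z s) ν := by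
  have := hν.finite
  refine Integrable.of_bound
    ((continuous_apply j).mul (continuous_constantWealth z T)).aestronglyMeasurable
    (∏ s ∈ Finset.range T, ∑ j, z s j) ?_
  filter_upwards [hν.ae_mem] with b hb
  rw [norm_mul, Real.norm_of_nonneg (hb.1 j)]
  exact (mul_le_of_le_one_left (norm_nonneg _) (component_le_one hb j)).trans
    (abs_constantWealth_le hz hb T)

/-- The mixture loses against a constant portfolio `c` at most a constant factor and the factor
`1 - ε` per period. -/
theorem IsPrior.le_mixtureWealth (hν : IsPrior ν) {z : ℕ → Fin m → ℝ} (hz : ∀ s j, 0 < z s j)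
    {c : Fin m → ℝ} (hc : c ∈ stdSimplex ℝ (Fin m)) {ε : ℝ} (hε1 : ε < 1) (T : ℕ) :
    ν.real (nearPortfolios c ε) * ∏ s ∈ Finset.range T, (1 - ε) * (c ⬝ᵥ z s) ≤
      mixtureWealth ν z T := by
  have := hν.finite
  have hO := (isOpen_nearPortfolios c ε).measurableSet
  calc ν.real (nearPortfolios c ε) * ∏ s ∈ Finset.range T, (1 - ε) * (c ⬝ᵥ z s)
      = ∫ _ in nearPortfolios c ε, ∏ s ∈ Finset.range T, (1 - ε) * (c ⬝ᵥ z s) ∂ν := by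
        rw [setIntegral_const, smul_eq_mul]
    _ ≤ ∫ b in nearPortfolios c ε, ∏ s ∈ Finset.range T, b ⬝ᵥ z s ∂ν := by
        refine setIntegral_mono_on (integrable_const _).integrableOn
          (hν.integrable_constantWealth hz T).integrableOn hO fun b hb => ?_
        refine Finset.prod_le_prod (fun s _ => mul_nonneg (by linarith)
          (dotProduct_pos_of_mem_stdSimplex hc (hz s)).le) fun s _ => ?_
        rw [dotProduct, Finset.mul_sum]
        refine Finset.sum_le_sum fun j _ => ?_
        rw [← mul_assoc]
        exact mul_le_mul_of_nonneg_right (hb j).le (hz s j).le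
    _ ≤ mixtureWealth ν z T := by
        refine setIntegral_le_integral (hν.integrable_constantWealth hz T) ?_
        filter_upwards [hν.ae_mem] with b hb
        exact Finset.prod_nonneg fun s _ => (dotProduct_pos_of_mem_stdSimplex hb (hz s)).le

theorem IsPrior.measureReal_nearPortfolios_pos (hν : IsPrior ν) {c : Fin m → ℝ}
    (hc : c ∈ stdSimplex ℝ (Fin m)) {ε : ℝ} (hε0 : 0 < ε) (hε1 : ε < 1) :
    0 < ν.real (nearPortfolios c ε) := by
  have := hν.finite
  exact ENNReal.toReal_pos (hν.near_pos c hc ε hε0 hε1).ne' (measure_ne_top _ _)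

theorem IsPrior.mixtureWealth_pos (hν : IsPrior ν) {z : ℕ → Fin m → ℝ} (hz : ∀ s j, 0 < z s j)
    {c : Fin m → ℝ} (hc : c ∈ stdSimplex ℝ (Fin m)) (T : ℕ) : 0 < mixtureWealth ν z T := by
  refine lt_of_lt_of_le (mul_pos
    (hν.measureReal_nearPortfolios_pos hc (ε := 1 / 2) (by norm_num) (by norm_num))
    (Finset.prod_pos fun s _ => ?_)) (hν.le_mixtureWealth hz hc (by norm_num) T)
  exact mul_pos (by norm_num) (dotProduct_pos_of_mem_stdSimplex hc (hz s))

/-- By linearity, pairing the unnormalized wealth-weighted mean portfolio with the next return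
vector inserts one more factor `b ⬝ᵥ z T` under the integral. -/
theorem IsPrior.sum_component_mixture (hν : IsPrior ν) {z : ℕ → Fin m → ℝ}
    (hz : ∀ s j, 0 < z s j) (T : ℕ) :
    ∑ j, (∫ b, b j * ∏ s ∈ Finset.range T, b ⬝ᵥ z s ∂ν) * z T j = mixtureWealth ν z (T + 1) := by
  simp only [← integral_mul_const]
  rw [← integral_finsetSum _ fun j _ =>
    (hν.integrable_component_mul_constantWealth hz T j).mul_const _, mixtureWealth]
  refine integral_congr_ae (ae_of_all _ fun b => ?_)
  simp only [Finset.prod_range_succ, dotProduct, Finset.mul_sum]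
  exact Finset.sum_congr rfl fun j _ => by ring

end Mixture

/-! ### The learning strategy along a residue class -/

theorem subsequenceWealth_eq {m K : ℕ} {s r : ℕ} (hr : r < K) (x : ℕ → Fin m → ℝ)
    (b : Fin m → ℝ) :
    subsequenceWealth K (K * s + r) (fun i : Fin (K * s + r) => x i) b =
      ∏ u ∈ Finset.range s, b ⬝ᵥ x (K * u + r) := by
  have hdiv : (K * s + r) / K = s := by
    rw [Nat.mul_add_div (by omega), Nat.div_eq_of_lt hr, add_zero]
  have hmod : (K * s + r) % K = r := by
    rw [Nat.mul_add_mod, Nat.mod_eq_of_lt hr]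
  have h := Finset.prod_range (n := (K * s + r) / K) fun u => b ⬝ᵥ x (K * u + (K * s + r) % K)
  rw [subsequenceWealth, ← h, hdiv, hmod]

/-- The return of a strategy in period `s` of the residue class `r` modulo `K`. -/
def residueReturn {m : ℕ} (b : Strategy m) (x : ℕ → Fin m → ℝ) (K r s : ℕ) : ℝ :=
  (b (K * s + r) fun i : Fin (K * s + r) => x i) ⬝ᵥ x (K * s + r)

section Learning

variable {m : ℕ} {ρ : (Fin m → ℝ) → ℝ} {x : ℕ → Fin m → ℝ} {K r : ℕ}

theorem learningStrategy_residueReturn_zero (hr : r < K) :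
    residueReturn (learningStrategy m K ρ) x K r 0 = (fun _ => 1 / (m : ℝ)) ⬝ᵥ x r := by
  have : K * 0 + r = r := by simp
  rw [residueReturn, this]
  congr 1
  funext j
  simp [learningStrategy, hr]

theorem learningStrategy_residueReturn_succ (hm : 1 ≤ m) (hρ : Measurable ρ)
    (hρ0 : ∀ b ∈ stdSimplex ℝ (Fin m), 0 ≤ ρ b) (hν : IsPrior (densityMeasure m ρ))
    (hx : ∀ n j, 0 < x n j) (hr : r < K) (s : ℕ) :
    residueReturn (learningStrategy m K ρ) x K r (s + 1) =
      mixtureWealth (densityMeasure m ρ) (fun u => x (K * u + r)) (s + 1 + 1) /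
        mixtureWealth (densityMeasure m ρ) (fun u => x (K * u + r)) (s + 1) := by
  have hge : ¬ K * (s + 1) + r < K := by
    rw [Nat.mul_add]
    omega
  rw [← hν.sum_component_mixture (fun u => hx (K * u + r)), Finset.sum_div, residueReturn,
    dotProduct]
  refine Finset.sum_congr rfl fun j _ => ?_
  simp only [learningStrategy, hge, if_false, subsequenceWealth_eq hr]
  rw [integral_densityMeasure hm hρ hρ0, integral_densityMeasure hm hρ hρ0, mixtureWealth]
  ring

/-- The quotients of consecutive mixture wealths telescope. The first factor is kept separate, as
the first portfolio is uniform by definition. The portfolio `c` serves only to make the mixture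
wealth positive. -/
theorem prod_residueReturn_succ (hm : 1 ≤ m) (hρ : Measurable ρ)
    (hρ0 : ∀ b ∈ stdSimplex ℝ (Fin m), 0 ≤ ρ b) (hν : IsPrior (densityMeasure m ρ))
    (hx : ∀ n j, 0 < x n j) (hr : r < K) {c : Fin m → ℝ} (hc : c ∈ stdSimplex ℝ (Fin m)) (T : ℕ) :
    ∏ s ∈ Finset.range (T + 1), residueReturn (learningStrategy m K ρ) x K r s =
      residueReturn (learningStrategy m K ρ) x K r 0 /
        mixtureWealth (densityMeasure m ρ) (fun u => x (K * u + r)) 1 *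
        mixtureWealth (densityMeasure m ρ) (fun u => x (K * u + r)) (T + 1) := by
  have hV := hν.mixtureWealth_pos (fun u => hx (K * u + r)) hc
  induction T with
  | zero =>
    have := (hV 1).ne'
    simp only [zero_add, Finset.prod_range_one]
    field_simp
  | succ T ih =>
    have h1 := (hV 1).ne'
    have h2 := (hV (T + 1)).ne'
    rw [Finset.prod_range_succ, ih, learningStrategy_residueReturn_succ hm hρ hρ0 hν hx hr]
    field_simp

/-- Along a residue class the learning strategy earns the wealth of the mixture up to constant
factors. -/
theorem exists_bounds_prod_residueReturn (hm : 1 ≤ m) (hρ : Measurable ρ)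
    (hρ0 : ∀ b ∈ stdSimplex ℝ (Fin m), 0 ≤ ρ b) (hν : IsPrior (densityMeasure m ρ))
    (hx : ∀ n j, 0 < x n j) (hr : r < K) {c : Fin m → ℝ} (hc : c ∈ stdSimplex ℝ (Fin m)) :
    ∃ a A : ℝ, 0 < a ∧ 0 < A ∧ ∀ T,
      a * mixtureWealth (densityMeasure m ρ) (fun u => x (K * u + r)) T ≤
        ∏ s ∈ Finset.range T, residueReturn (learningStrategy m K ρ) x K r s ∧
      ∏ s ∈ Finset.range T, residueReturn (learningStrategy m K ρ) x K r s ≤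
        A * mixtureWealth (densityMeasure m ρ) (fun u => x (K * u + r)) T := by
  have hV := hν.mixtureWealth_pos (fun u => hx (K * u + r)) hc
  set V := mixtureWealth (densityMeasure m ρ) (fun u => x (K * u + r)) with hVdef
  have hg0 : 0 < residueReturn (learningStrategy m K ρ) x K r 0 := by
    rw [learningStrategy_residueReturn_zero hr]
    have : (0 : ℝ) < m := by exact_mod_cast hm
    refine Finset.sum_pos (fun j _ => mul_pos (by positivity) (hx r j)) ?_
    exact ⟨⟨0, hm⟩, Finset.mem_univ _⟩
  set q := residueReturn (learningStrategy m K ρ) x K r 0 / V 1 with hq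
  have hq0 : 0 < q := div_pos hg0 (hV 1)
  have hV0 : 0 < 1 / V 0 := one_div_pos.2 (hV 0)
  -- The empty product at `T = 0` needs its own constant `1 / V 0`; all other `T` share `q`.
  have hcase : ∀ T, ∃ p, (p = q ∨ p = 1 / V 0) ∧
      ∏ s ∈ Finset.range T, residueReturn (learningStrategy m K ρ) x K r s = p * V T := by
    rintro (_ | T)
    · refine ⟨_, Or.inr rfl, ?_⟩
      rw [Finset.prod_range_zero, one_div_mul_cancel (hV 0).ne']
    · exact ⟨_, Or.inl rfl, prod_residueReturn_succ hm hρ hρ0 hν hx hr hc T⟩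
  refine ⟨min q (1 / V 0), max q (1 / V 0), lt_min hq0 hV0, lt_max_of_lt_left hq0, fun T => ?_⟩
  obtain ⟨p, hp, h⟩ := hcase T
  rw [h]
  constructor
  · refine mul_le_mul_of_nonneg_right ?_ (hV T).le
    rcases hp with rfl | rfl
    · exact min_le_left _ _
    · exact min_le_right _ _
  · refine mul_le_mul_of_nonneg_right ?_ (hV T).le
    rcases hp with rfl | rfl
    · exact le_max_left _ _
    · exact le_max_right _ _

end Learning

/-! ### Grouping the periods into residue classes -/

theorem count_mod_eq_self {K : ℕ} (hK : 0 < K) (n : ℕ) :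
    Nat.count (fun i => i % K = n % K) n = n / K := by
  have h := Nat.count_modEq_card n hK (n % K)
  simp only [Nat.mod_mod, lt_self_iff_false, if_false, add_zero] at h
  rw [← h]
  simp only [Nat.ModEq, Nat.mod_mod]

/-- Period `i` is visit number `i / K` to the class `i % K`, so each new period extends exactly one
inner product. Counting visits allows any horizon `n`, not just multiples of `K`. -/
theorem prod_range_eq_prod_residues {K : ℕ} (hK : 0 < K) (g : ℕ → ℕ → ℝ) (n : ℕ) :
    ∏ i ∈ Finset.range n, g (i % K) (i / K) =
      ∏ r ∈ Finset.range K, ∏ s ∈ Finset.range (Nat.count (fun i => i % K = r) n), g r s := by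
  induction n with
  | zero => simp
  | succ n ih =>
    have hstep : ∀ r, ∏ s ∈ Finset.range (Nat.count (fun i => i % K = r) (n + 1)), g r s =
        (∏ s ∈ Finset.range (Nat.count (fun i => i % K = r) n), g r s) *
          if n % K = r then g r (n / K) else 1 := fun r => by
      rw [Nat.count_succ]
      split_ifs with h
      · subst h
        rw [Finset.prod_range_succ, count_mod_eq_self hK]
      · rw [add_zero, mul_one]
    simp only [hstep]
    rw [Finset.prod_mul_distrib, Finset.prod_range_succ, ih, Finset.prod_ite_eq,
      if_pos (Finset.mem_range.2 (Nat.mod_lt n hK))]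

theorem wealth_eq_prod_residues {m K : ℕ} (hK : 0 < K) (b : Strategy m) (x : ℕ → Fin m → ℝ)
    (n : ℕ) :
    wealth b x n = ∏ r ∈ Finset.range K,
      ∏ s ∈ Finset.range (Nat.count (fun i => i % K = r) n), residueReturn b x K r s := by
  rw [← prod_range_eq_prod_residues hK, wealth]
  refine Finset.prod_congr rfl fun i _ => ?_
  rw [residueReturn, Nat.div_add_mod]

/-- Since `k` divides `d * k`, the position in the `k`-cycle is constant along the class. -/
theorem cyclicStrategy_residueReturn {m k : ℕ} [NeZero k] (c : Fin k → Fin m → ℝ)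
    (x : ℕ → Fin m → ℝ) (d r s : ℕ) :
    residueReturn (cyclicStrategy c) x (d * k) r s = c (Fin.ofNat k r) ⬝ᵥ x (d * k * s + r) := by
  have : Fin.ofNat k (d * k * s + r) = Fin.ofNat k r := by
    ext
    simp [Fin.ofNat, mul_right_comm d k s]
  rw [residueReturn, cyclicStrategy, this]

/-! ### Subexponential ratios -/

theorem tendsto_inv_mul_log_of_subexponential {Q : ℕ → ℝ} {C : ℝ} {p : ℕ} (hC : 0 < C)
    (hupper : ∀ n, Q n ≤ C * ((n : ℝ) + 1) ^ p)
    (hlower : ∀ ε : ℝ, 0 < ε → ε < 1 → ∃ a, 0 < a ∧ ∀ n : ℕ, a * (1 - ε) ^ n ≤ Q n) :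
    Tendsto (fun n : ℕ => (1 / (n : ℝ)) * Real.log (Q n)) atTop (𝓝 0) := by
  have hQ : ∀ n, 0 < Q n := fun n => by
    obtain ⟨a, ha, h⟩ := hlower (1 / 2) (by norm_num) (by norm_num)
    exact lt_of_lt_of_le (by positivity) (h n)
  have hconst : ∀ a : ℝ, Tendsto (fun n : ℕ => a / (n : ℝ)) atTop (𝓝 0) :=
    tendsto_const_div_atTop_nhds_zero_nat
  have hlogn : Tendsto (fun n : ℕ => Real.log ((n : ℝ) + 1) / (n : ℝ)) atTop (𝓝 0) := by
    have h1 : Tendsto (fun n : ℕ => Real.log (((n + 1 : ℕ) : ℝ)) / ((n + 1 : ℕ) : ℝ)) atTop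
        (𝓝 0) :=
      ((Real.isLittleO_log_id_atTop.tendsto_div_nhds_zero).comp
        tendsto_natCast_atTop_atTop).comp (tendsto_add_atTop_nat 1)
    -- Uses `log (n + 1) / n = log (n + 1) / (n + 1) * (1 + 1 / n)`.
    have h2 := h1.mul ((hconst 1).const_add 1)
    rw [zero_mul] at h2
    refine h2.congr' ?_
    filter_upwards [eventually_gt_atTop 0] with n hn
    have : (0 : ℝ) < n := by exact_mod_cast hn
    push_cast
    field_simp
  rw [tendsto_order]
  constructor
  · intro η hη
    -- With `ε = 1 - exp (η / 2)` the factor `(1 - ε) ^ n` costs exactly `η / 2` per period; the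
    -- other half of `η` absorbs `log a / n`.
    have hε0 : 0 < 1 - Real.exp (η / 2) := by
      have : Real.exp (η / 2) < 1 := Real.exp_lt_one_iff.2 (by linarith)
      linarith
    obtain ⟨a, ha, h⟩ := hlower _ hε0 (by have := Real.exp_pos (η / 2); linarith)
    have hev := (tendsto_order.1 (hconst (Real.log a))).1 (η / 2) (by linarith)
    filter_upwards [hev, eventually_gt_atTop 0] with n hn hn0
    have hn' : (0 : ℝ) < n := by exact_mod_cast hn0
    have hlog : Real.log a + n * (η / 2) ≤ Real.log (Q n) := by
      have := Real.log_le_log (by rw [sub_sub_cancel]; positivity) (h n)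
      rwa [sub_sub_cancel, Real.log_mul ha.ne' (by positivity), Real.log_pow, Real.log_exp] at this
    calc η = η / 2 + η / 2 := by ring
      _ < Real.log a / n + η / 2 := by linarith
      _ = 1 / n * (Real.log a + n * (η / 2)) := by field_simp
      _ ≤ 1 / n * Real.log (Q n) := by gcongr
  · intro η hη
    have hlim := (hconst (Real.log C)).add (hlogn.const_mul (p : ℝ))
    rw [mul_zero, add_zero] at hlim
    filter_upwards [(tendsto_order.1 hlim).2 η hη, eventually_gt_atTop 0] with n hn hn0
    have hn' : (0 : ℝ) < n := by exact_mod_cast hn0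
    have hlog := Real.log_le_log (hQ n) (hupper n)
    rw [Real.log_mul hC.ne' (by positivity), Real.log_pow] at hlog
    calc 1 / (n : ℝ) * Real.log (Q n)
        ≤ 1 / n * (Real.log C + p * Real.log ((n : ℝ) + 1)) := by gcongr
      _ = Real.log C / n + p * (Real.log ((n : ℝ) + 1) / n) := by ring
      _ < η := hn

/-- If the mixtures along all residue classes earn at most polynomially more than the cyclic
strategy, then the learning strategy and the cyclic strategy have the same growth rate. -/
theorem tendsto_growthRate_sub {m k d : ℕ} [NeZero k] (hm : 1 ≤ m) (hd : 1 ≤ d)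
    {ρ : (Fin m → ℝ) → ℝ} (hρ : Measurable ρ) (hρ0 : ∀ b ∈ stdSimplex ℝ (Fin m), 0 ≤ ρ b)
    (hν : IsPrior (densityMeasure m ρ)) {x : ℕ → Fin m → ℝ} (hx : ∀ n j, 0 < x n j)
    {c : Fin k → Fin m → ℝ} (hc : ∀ i, c i ∈ stdSimplex ℝ (Fin m))
    (hupper : ∀ r, ∃ A : ℝ, ∀ T : ℕ,
      mixtureWealth (densityMeasure m ρ) (fun u => x (d * k * u + r)) T ≤
        A * ((T : ℝ) + 1) ^ 2 *
          ∏ s ∈ Finset.range T, c (Fin.ofNat k r) ⬝ᵥ x (d * k * s + r)) :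
    Tendsto (fun n : ℕ => growthRate (learningStrategy m (d * k) ρ) x n -
      growthRate (cyclicStrategy c) x n) atTop (𝓝 0) := by
  have hK : 0 < d * k := Nat.mul_pos hd (NeZero.pos k)
  set K := d * k with hKdef
  have hcx : ∀ r n, 0 < c (Fin.ofNat k r) ⬝ᵥ x n := fun r n =>
    dotProduct_pos_of_mem_stdSimplex (hc _) (hx n)
  have hw : ∀ n, wealth (cyclicStrategy c) x n = ∏ r ∈ Finset.range K,
      ∏ s ∈ Finset.range (Nat.count (fun i => i % K = r) n),
        c (Fin.ofNat k r) ⬝ᵥ x (K * s + r) := fun n => by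
    rw [wealth_eq_prod_residues hK]
    simp only [hKdef, cyclicStrategy_residueReturn]
  have hwpos : ∀ n, 0 < wealth (cyclicStrategy c) x n := fun n => by
    rw [hw]
    exact Finset.prod_pos fun r _ => Finset.prod_pos fun s _ => hcx r _
  -- A constant is provided for every `r`, with a dummy value for `r ≥ K`, so that `choose` yields a
  -- function of `r` alone.
  have hU : ∀ r, ∃ B : ℝ, 0 < B ∧ (r < K → ∀ T : ℕ,
      0 ≤ ∏ s ∈ Finset.range T, residueReturn (learningStrategy m K ρ) x K r s ∧
      ∏ s ∈ Finset.range T, residueReturn (learningStrategy m K ρ) x K r s ≤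
        B * ((T : ℝ) + 1) ^ 2 *
          ∏ s ∈ Finset.range T, c (Fin.ofNat k r) ⬝ᵥ x (K * s + r)) := fun r => by
    by_cases hr : r < K
    swap
    · exact ⟨1, one_pos, fun h => absurd h hr⟩
    obtain ⟨A, hA⟩ := hupper r
    obtain ⟨a, A', ha, hA', h⟩ :=
      exists_bounds_prod_residueReturn hm hρ hρ0 hν hx hr (hc (Fin.ofNat k r))
    refine ⟨A' * max A 1, mul_pos hA' (lt_max_of_lt_right one_pos), fun _ T => ⟨?_, ?_⟩⟩
    · exact (mul_nonneg ha.le (hν.mixtureWealth_pos (fun u => hx (K * u + r))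
        (hc (Fin.ofNat k r)) T).le).trans (h T).1
    have hprod : 0 < ∏ s ∈ Finset.range T, c (Fin.ofNat k r) ⬝ᵥ x (K * s + r) :=
      Finset.prod_pos fun s _ => hcx r _
    calc _ ≤ A' * mixtureWealth (densityMeasure m ρ) (fun u => x (K * u + r)) T := (h T).2
      _ ≤ A' * (A * ((T : ℝ) + 1) ^ 2 *
          ∏ s ∈ Finset.range T, c (Fin.ofNat k r) ⬝ᵥ x (K * s + r)) := by
          gcongr
          exact hA T
      _ ≤ A' * (max A 1 * ((T : ℝ) + 1) ^ 2 *
          ∏ s ∈ Finset.range T, c (Fin.ofNat k r) ⬝ᵥ x (K * s + r)) := by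
          gcongr
          exact le_max_left _ _
      _ = _ := by ring
  choose B hB0 hB using hU
  have hL : ∀ ε : ℝ, 0 < ε → ε < 1 → ∀ r, ∃ a : ℝ, 0 < a ∧ (r < K → ∀ T : ℕ,
      a * ∏ s ∈ Finset.range T, ((1 - ε) * (c (Fin.ofNat k r) ⬝ᵥ x (K * s + r))) ≤
        ∏ s ∈ Finset.range T, residueReturn (learningStrategy m K ρ) x K r s) := by
    intro ε hε0 hε1 r
    by_cases hr : r < K
    swap
    · exact ⟨1, one_pos, fun h => absurd h hr⟩
    obtain ⟨a, A', ha, hA', h⟩ :=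
      exists_bounds_prod_residueReturn hm hρ hρ0 hν hx hr (hc (Fin.ofNat k r))
    refine ⟨_, mul_pos ha (hν.measureReal_nearPortfolios_pos (hc (Fin.ofNat k r)) hε0 hε1),
      fun _ T => ?_⟩
    refine le_trans ?_ (h T).1
    rw [mul_assoc]
    gcongr
    exact hν.le_mixtureWealth (fun u => hx (K * u + r)) (hc (Fin.ofNat k r)) hε1 T
  have hlim : Tendsto (fun n : ℕ => (1 / (n : ℝ)) * Real.log
      (wealth (learningStrategy m K ρ) x n / wealth (cyclicStrategy c) x n)) atTop (𝓝 0) := by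
    -- Each of the `K` classes contributes a factor `(T + 1) ^ 2` with `T ≤ n`, whence the exponent
    -- `2 * K`.
    refine tendsto_inv_mul_log_of_subexponential (C := ∏ r ∈ Finset.range K, B r) (p := 2 * K)
      (Finset.prod_pos fun r _ => hB0 r) (fun n => ?_) fun ε hε0 hε1 => ?_
    · rw [div_le_iff₀ (hwpos n), wealth_eq_prod_residues hK, hw, pow_mul]
      have hcard : (((n : ℝ) + 1) ^ 2) ^ K = ∏ _r ∈ Finset.range K, ((n : ℝ) + 1) ^ 2 := by simp
      rw [hcard, ← Finset.prod_mul_distrib, ← Finset.prod_mul_distrib]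
      refine Finset.prod_le_prod (fun r hr => (hB r (Finset.mem_range.1 hr) _).1) fun r hr => ?_
      refine (hB r (Finset.mem_range.1 hr) _).2.trans ?_
      refine mul_le_mul_of_nonneg_right ?_ (Finset.prod_nonneg fun s _ => (hcx r _).le)
      refine mul_le_mul_of_nonneg_left ?_ (hB0 r).le
      gcongr
      exact Nat.count_le _
    · choose a ha0 ha using hL ε hε0 hε1
      refine ⟨∏ r ∈ Finset.range K, a r, Finset.prod_pos fun r _ => ha0 r, fun n => ?_⟩
      rw [le_div_iff₀ (hwpos n)]
      -- The visits to all classes add up to `n`: the regrouping lemma for a constant factor.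
      have hpow : (1 - ε) ^ n = ∏ r ∈ Finset.range K,
          ∏ _s ∈ Finset.range (Nat.count (fun i => i % K = r) n), (1 - ε) := by
        rw [← prod_range_eq_prod_residues hK fun _ _ => 1 - ε]
        simp
      rw [hw, wealth_eq_prod_residues hK, hpow, ← Finset.prod_mul_distrib,
        ← Finset.prod_mul_distrib]
      refine Finset.prod_le_prod (fun r _ => ?_) fun r hr => ?_
      · refine mul_nonneg (mul_nonneg (ha0 r).le (Finset.prod_nonneg fun _ _ => by linarith))
          (Finset.prod_nonneg fun s _ => (hcx r _).le)
      · rw [mul_assoc, ← Finset.prod_mul_distrib]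
        exact ha r (Finset.mem_range.1 hr) _
  have hlpos : ∀ n, 0 < wealth (learningStrategy m K ρ) x n := fun n => by
    choose a ha0 ha using hL (1 / 2) (by norm_num) (by norm_num)
    rw [wealth_eq_prod_residues hK]
    refine Finset.prod_pos fun r hr => lt_of_lt_of_le (mul_pos (ha0 r) ?_)
      (ha r (Finset.mem_range.1 hr) _)
    exact Finset.prod_pos fun s _ => mul_pos (by norm_num) (hcx r _)
  refine hlim.congr fun n => ?_
  rw [Real.log_div (hlpos n).ne' (hwpos n).ne', growthRate, growthRate]
  ring

/-! ### Upper bound for the wealth of the mixture -/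

section Upper

variable {Ω : Type*} [MeasurableSpace Ω] {P : Measure Ω} {m : ℕ} {ν : Measure (Fin m → ℝ)}

theorem tsum_ofReal_one_div_succ_sq_ne_top :
    ∑' T : ℕ, ENNReal.ofReal (1 / ((T : ℝ) + 1) ^ 2) ≠ ⊤ := by
  have h : Summable fun T : ℕ => 1 / ((T : ℝ) + 1) ^ 2 := by
    have := (summable_nat_add_iff 1).2 (Real.summable_one_div_nat_pow.2 (by norm_num : 1 < 2))
    simpa using this
  exact h.tsum_ofReal_ne_top

/-- Nonnegative random variables with bounded expectations grow at most polynomially. -/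
theorem ae_exists_le_mul_sq {Z : ℕ → Ω → ENNReal} (hZ : ∀ T, Measurable (Z T)) {M : ENNReal}
    (hM : M ≠ ⊤) (h : ∀ T, ∫⁻ ω, Z T ω ∂P ≤ M) :
    ∀ᵐ ω ∂P, ∃ A : ℝ, ∀ T : ℕ, Z T ω ≤ ENNReal.ofReal (A * ((T : ℝ) + 1) ^ 2) := by
  let w : ℕ → ENNReal := fun T => ENNReal.ofReal (1 / ((T : ℝ) + 1) ^ 2)
  -- The weights are summable, so the weighted series has finite mean and is almost surely finite;
  -- its sum then bounds each of its terms.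
  have hsum : ∫⁻ ω, ∑' T, w T * Z T ω ∂P ≠ ⊤ := by
    rw [lintegral_tsum fun T => ((hZ T).const_mul _).aemeasurable]
    have hle : ∑' T, ∫⁻ ω, w T * Z T ω ∂P ≤ ∑' T, w T * M := by
      refine ENNReal.tsum_le_tsum fun T => ?_
      rw [lintegral_const_mul _ (hZ T)]
      gcongr
      exact h T
    refine (hle.trans_lt ?_).ne
    rw [ENNReal.tsum_mul_right]
    exact ENNReal.mul_lt_top tsum_ofReal_one_div_succ_sq_ne_top.lt_top hM.lt_top
  have hae := ae_lt_top (Measurable.tsum fun T => (hZ T).const_mul (w T)) hsum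
  filter_upwards [hae] with ω hω
  refine ⟨(∑' T, w T * Z T ω).toReal, fun T => ?_⟩
  have hT : w T * Z T ω ≤ ∑' T, w T * Z T ω := ENNReal.le_tsum T
  have hpos : (0 : ℝ) < ((T : ℝ) + 1) ^ 2 := by positivity
  rw [ENNReal.ofReal_mul ENNReal.toReal_nonneg, ENNReal.ofReal_toReal hω.ne]
  have hw : w T * ENNReal.ofReal (((T : ℝ) + 1) ^ 2) = 1 := by
    rw [← ENNReal.ofReal_mul (by positivity), one_div_mul_cancel hpos.ne', ENNReal.ofReal_one]
  calc Z T ω = w T * Z T ω * ENNReal.ofReal (((T : ℝ) + 1) ^ 2) := by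
        rw [mul_right_comm, hw, one_mul]
    _ ≤ _ := by gcongr

/-- A mixture of constant portfolios on independent returns earns at most polynomially more than a
portfolio that satisfies the Kuhn-Tucker conditions in every period. -/
theorem IsPrior.ae_exists_mixtureWealth_le (hν : IsPrior ν) {z : ℕ → Ω → Fin m → ℝ}
    (hz : ∀ s, Measurable (z s)) (hpos : ∀ s ω j, 0 < z s ω j) (hind : iIndepFun z P)
    {c : Fin m → ℝ} (hc : c ∈ stdSimplex ℝ (Fin m))
    (hKT : ∀ b ∈ stdSimplex ℝ (Fin m), ∀ s,
      ∫⁻ ω, ENNReal.ofReal ((b ⬝ᵥ z s ω) / (c ⬝ᵥ z s ω)) ∂P ≤ 1) :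
    ∀ᵐ ω ∂P, ∃ A : ℝ, ∀ T : ℕ, mixtureWealth ν (fun s => z s ω) T ≤
      A * ((T : ℝ) + 1) ^ 2 * ∏ s ∈ Finset.range T, c ⬝ᵥ z s ω := by
  have := hν.finite
  have := hind.isProbabilityMeasure
  let F : ℕ → Ω × (Fin m → ℝ) → ENNReal := fun s p =>
    ENNReal.ofReal ((p.2 ⬝ᵥ z s p.1) / (c ⬝ᵥ z s p.1))
  have hF : ∀ s, Measurable (F s) := fun s => by
    have h1 := hz s
    refine Measurable.ennreal_ofReal (Measurable.div ?_ ?_)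
    · simp only [dotProduct]
      fun_prop
    · simp only [dotProduct]
      fun_prop
  have hG : ∀ T, Measurable fun p => ∏ s ∈ Finset.range T, F s p := fun T =>
    Finset.measurable_prod _ fun s _ => hF s
  -- After Tonelli, `b` is fixed, independence factors the mean of the product, and each factor is
  -- at most `1` by `hKT`.
  have hE : ∀ T, ∫⁻ ω, ∫⁻ b, ∏ s ∈ Finset.range T, F s (ω, b) ∂ν ∂P ≤ ν Set.univ := fun T => by
    rw [lintegral_lintegral_swap (hG T).aemeasurable]
    calc ∫⁻ b, ∫⁻ ω, ∏ s ∈ Finset.range T, F s (ω, b) ∂P ∂ν ≤ ∫⁻ _, 1 ∂ν := by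
          refine lintegral_mono_ae ?_
          filter_upwards [hν.ae_mem] with b hb
          have hφ : Measurable fun y : Fin m → ℝ => ENNReal.ofReal ((b ⬝ᵥ y) / (c ⬝ᵥ y)) := by
            simp only [dotProduct]
            fun_prop
          rw [lintegral_prod_eq_prod_lintegral_of_indepFun (Finset.range T)
            (fun s ω => F s (ω, b)) (hind.comp _ fun _ => hφ) fun s => hφ.comp (hz s)]
          exact Finset.prod_le_one' fun s _ => hKT b hb s
      _ = ν Set.univ := by simp
  have hmeas : ∀ T, Measurable fun ω => ∫⁻ b, ∏ s ∈ Finset.range T, F s (ω, b) ∂ν := fun T =>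
    (hG T).lintegral_prod_right'
  filter_upwards [ae_exists_le_mul_sq hmeas (measure_ne_top ν Set.univ) hE] with ω ⟨A, hA⟩
  -- A nonnegative constant lets the `ENNReal.ofReal` inequality be read back in `ℝ`.
  refine ⟨max A 0, fun T => ?_⟩
  have hprod : 0 < ∏ s ∈ Finset.range T, c ⬝ᵥ z s ω :=
    Finset.prod_pos fun s _ => dotProduct_pos_of_mem_stdSimplex hc (hpos s ω)
  have hint := (hν.integrable_constantWealth (fun s => hpos s ω) T).div_const
    (∏ s ∈ Finset.range T, c ⬝ᵥ z s ω)
  have heq : ENNReal.ofReal (mixtureWealth ν (fun s => z s ω) T /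
      ∏ s ∈ Finset.range T, c ⬝ᵥ z s ω) = ∫⁻ b, ∏ s ∈ Finset.range T, F s (ω, b) ∂ν := by
    rw [mixtureWealth, ← integral_div, ofReal_integral_eq_lintegral_ofReal hint]
    · refine lintegral_congr_ae ?_
      filter_upwards [hν.ae_mem] with b hb
      rw [← Finset.prod_div_distrib, ENNReal.ofReal_prod_of_nonneg]
      exact fun s _ => (div_pos (dotProduct_pos_of_mem_stdSimplex hb (hpos s ω))
        (dotProduct_pos_of_mem_stdSimplex hc (hpos s ω))).le
    · filter_upwards [hν.ae_mem] with b hb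
      exact div_nonneg (Finset.prod_nonneg fun s _ =>
        (dotProduct_pos_of_mem_stdSimplex hb (hpos s ω)).le) hprod.le
  have hle := hA T
  rw [← heq] at hle
  rw [← div_le_iff₀ hprod]
  have hle' : ENNReal.ofReal (mixtureWealth ν (fun s => z s ω) T /
      ∏ s ∈ Finset.range T, c ⬝ᵥ z s ω) ≤ ENNReal.ofReal (max A 0 * ((T : ℝ) + 1) ^ 2) :=
    hle.trans (ENNReal.ofReal_le_ofReal (by gcongr; exact le_max_left _ _))
  exact (ENNReal.ofReal_le_ofReal_iff (by positivity)).1 hle'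

end Upper

/-- Locates each period of a residue class inside the block structure: the block index `d * s + r /
k` moves with `s`, while the position in the block does not. -/
theorem block_apply_ofNat {Ω : Type*} {m k : ℕ} [NeZero k] (X : ℕ → Ω → Fin m → ℝ) (d r s : ℕ) (ω : Ω) :
    block k X (d * s + r / k) ω (Fin.ofNat k r) = X (d * k * s + r) ω := by
  have : k * (d * s + r / k) + r % k = d * k * s + r := by
    have := Nat.div_add_mod r k
    rw [Nat.mul_add, add_assoc, this]
    ring
  simp only [block, Fin.ofNat, this]

end CyclicPortfolio

end

theorem corollary2 {Ω : Type*} [MeasurableSpace Ω] (P : Measure Ω) [IsProbabilityMeasure P]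
    (m : ℕ) (hm : 2 ≤ m) (k : ℕ) [NeZero k] (hk : 2 ≤ k) (d : ℕ) (hd : 1 ≤ d)
    (X : ℕ → Ω → Fin m → ℝ) (hX : ∀ n, Measurable (X n)) (hpos : ∀ n ω j, 0 < X n ω j)
    (hiid : CyclicPortfolio.IsBlockIID P k X)
    (bstar : Fin k → Fin m → ℝ)
    (hopt : CyclicPortfolio.IsLogOptimal P (CyclicPortfolio.block k X 0) bstar)
    (hfin : Integrable (CyclicPortfolio.logReturn (CyclicPortfolio.block k X 0) bstar) P)
    (ρ : (Fin m → ℝ) → ℝ)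
    (hρ : ρ = CyclicPortfolio.uniformDensity m ∨ ρ = CyclicPortfolio.dirichletDensity m (1 / 2)) :
    ∀ᵐ ω ∂P, Tendsto
      (fun t : ℕ =>
        CyclicPortfolio.growthRate (CyclicPortfolio.learningStrategy m (d * k) ρ)
            (fun n => X n ω) (k * t + k) -
          CyclicPortfolio.growthRate (CyclicPortfolio.cyclicStrategy bstar)
            (fun n => X n ω) (k * t + k))
      atTop (𝓝 0) := by
  obtain ⟨hmeas, hρpos, hρ0, hρfin⟩ := CyclicPortfolio.density_properties hm hρ
  have hν := CyclicPortfolio.isPrior_densityMeasure (by omega) hmeas hρpos hρfin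
  have hblock : ∀ t, Measurable (CyclicPortfolio.block k X t) := fun t =>
    measurable_pi_iff.2 fun i => hX _
  have hupper : ∀ r, ∀ᵐ ω ∂P, ∃ A : ℝ, ∀ T : ℕ,
      CyclicPortfolio.mixtureWealth (CyclicPortfolio.densityMeasure m ρ)
        (fun u => X (d * k * u + r) ω) T ≤ A * ((T : ℝ) + 1) ^ 2 *
          ∏ s ∈ Finset.range T, bstar (Fin.ofNat k r) ⬝ᵥ X (d * k * s + r) ω := by
    intro r
    -- Distinct periods of the class lie in distinct blocks, so independence of the blocks passes to
    -- the returns along the class.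
    have hinj : Function.Injective fun s : ℕ => d * s + r / k := fun s s' h => by
      have h' : d * s = d * s' := by simpa using h
      exact Nat.eq_of_mul_eq_mul_left hd h'
    refine hν.ae_exists_mixtureWealth_le (z := fun u => X (d * k * u + r)) (fun s => hX _)
      (fun s => hpos _) ?_ (hopt.1 _) fun b hb s => ?_
    · have := (hiid.1.precomp hinj).comp (fun _ β => β (Fin.ofNat k r))
        fun _ => measurable_pi_apply _
      convert this using 2 with s
      funext ω
      exact (CyclicPortfolio.block_apply_ofNat X d r s ω).symm
    · have hφ : Measurable fun β : Fin k → Fin m → ℝ => ENNReal.ofReal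
          ((b ⬝ᵥ β (Fin.ofNat k r)) / (bstar (Fin.ofNat k r) ⬝ᵥ β (Fin.ofNat k r))) := by
        refine Measurable.ennreal_ofReal (Measurable.div ?_ ?_)
        · simp only [dotProduct]
          fun_prop
        · simp only [dotProduct]
          fun_prop
      -- Identical distribution carries the Kuhn-Tucker inequality from block `0` to every other
      -- block.
      have heq := ((hiid.2 (d * s + r / k)).comp hφ).lintegral_eq
      simp only [Function.comp_def, CyclicPortfolio.block_apply_ofNat] at heq
      rw [heq]
      exact hopt.lintegral_ratio_le_one (hblock 0) (fun ω i => hpos _ ω) hfin _ hb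
  filter_upwards [ae_all_iff.2 hupper] with ω hω
  have hlim := CyclicPortfolio.tendsto_growthRate_sub (by omega) hd hmeas hρ0 hν
    (fun n => hpos n ω) hopt.1 hω
  -- The limit holds along all horizons `n`; the horizons `k * t + k` form a subsequence.
  refine hlim.comp (tendsto_atTop_mono (fun t => ?_) tendsto_id)
  have : t ≤ k * t := Nat.le_mul_of_pos_left t (by omega)
  exact this.trans (Nat.le_add_right _ _)
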